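/- Let the base stations (BSs) be the points $\Phi_b=\{\mathbf d_i\}_{i\in\mathbb N}\subset\mathbb R^2$ of a homogeneous Poisson point process of intensity $\lambda_b=\lambda_t/M_t$, where $\lambda_t>0$ is the transmit antenna density and $M_t\ge 2$ is the number of transmit antennas per BS. The typical user is at the origin. Let $D>0$ be the cooperation radius, $\alpha\ge 2$ the pathloss exponent and $p^c\in(0,1]$ the communication transmit power. The BSs in $\Phi_c=\{i:\|\mathbf d_i\|\le D\}$ jointly serve the user by non-coherent coordinated multi-point (CoMP) transmission and all other BSs interfere; noise is neglected. A cooperating BS $i$ has effective channel gain $S_i\sim\Gamma(M_t-1,p^c)$ and an interfering BS $j$ has channel gain $G_j\sim\Gamma(1,1)$ (shape, scale), where the pairs $(S_i,G_i)$, $i\in\mathbb N$, are independent of one another and (as a family) of $(\mathbf d_i)_{i\in\mathbb N}$. Put $$\mathrm{SIR}_c=\frac{\sum_{i\in\Phi_c}S_i\|\mathbf d_i\|^{-\alpha}}{\sum_{j\notin\Phi_c}G_j\|\mathbf d_j\|^{-\alpha}},\qquad R_c=\mathrm E\left[\log(1+\mathrm{SIR}_c)\right],$$ with the natural logarithm.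 Then the average data rate $R_c$ is finite and $$R_c=\int_0^\infty\frac{1-\exp\left[-\pi\lambda_b\,\mathrm H_1(zp^c,M_t-1,\alpha,D)\right]}{z}\,\exp\left[-\pi\lambda_b\,\mathrm H_2(z,\alpha,D)\right]\,\mathrm dz,$$ where $$\mathrm H_1(x,K,\alpha,D)=Kx^{2/\alpha}\,\bar B\left(\frac{x}{x+D^\alpha},1-\frac2\alpha,K+\frac2\alpha\right)+D^2\left(1-(1+xD^{-\alpha})^{-K}\right),$$ $$\mathrm H_2(x,\alpha,D)=D^2\left((1+xD^{-\alpha})^{-1}-1\right)+x^{2/\alpha}\,B\left(\frac{x}{x+D^\alpha},1-\frac2\alpha,1+\frac2\alpha\right),$$ and $B(t,a,b)=\int_0^t s^{a-1}(1-s)^{b-1}\,\mathrm ds$, $\bar B(t,a,b)=\int_t^1 s^{a-1}(1-s)^{b-1}\,\mathrm ds$ are the lower and the complementary incomplete Beta functions. For $\alpha=2$ the integral defining $B$ in $\mathrm H_2$ diverges, so that $\mathrm H_2=+\infty$, the second exponential is $0$, and the formula reads $R_c=0$ (the interference is then almost surely infinite). -/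

import Mathlib

open MeasureTheory ProbabilityTheory
open scoped ENNReal NNReal

noncomputable section

/-- The random number of points of the sequence `d` in the set `B`, counted with multiplicity. -/
def pointCount {Ω : Type*} (d : ℕ → Ω → EuclideanSpace ℝ (Fin 2))
    (B : Set (EuclideanSpace ℝ (Fin 2))) (ω : Ω) : ℕ∞ :=
  {i : ℕ | d i ω ∈ B}.encard

/-- The random points `d 0, d 1, d 2, …` of the plane form a homogeneous Poisson point process of
intensity `lam`: the number of points in a Borel set `B` of finite area has the Poisson law of mean
`lam * area B`, and the numbers of points in pairwise disjoint such sets are independent. -/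
structure IsHomogeneousPPP {Ω : Type*} [MeasurableSpace Ω] (P : Measure Ω) (lam : ℝ)
    (d : ℕ → Ω → EuclideanSpace ℝ (Fin 2)) : Prop where
  measurable : ∀ i, Measurable (d i)
  poisson : ∀ B : Set (EuclideanSpace ℝ (Fin 2)), MeasurableSet B → volume B ≠ ∞ →
    HasLaw (pointCount d B)
      ((poissonMeasure (lam.toNNReal * (volume B).toNNReal)).map (fun n : ℕ => (n : ℕ∞))) P
  indep : ∀ (n : ℕ) (B : Fin n → Set (EuclideanSpace ℝ (Fin 2))),
    (∀ k, MeasurableSet (B k)) → (∀ k, volume (B k) ≠ ∞) →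
    Pairwise (fun k l => Disjoint (B k) (B l)) →
    iIndepFun (fun k => pointCount d (B k)) P

/-- The (indices of the) cooperating base stations: those within distance `D` of the typical user,
who is at the origin. -/
def coopCluster {Ω : Type*} (d : ℕ → Ω → EuclideanSpace ℝ (Fin 2)) (D : ℝ) (ω : Ω) : Set ℕ :=
  {i | ‖d i ω‖ ≤ D}

/-- Useful power: the powers received from the cooperating base stations are accumulated
(non-coherent joint transmission). Base station `i` contributes gain times `‖d i‖ ^ (-α)`. -/
def usefulPower {Ω : Type*} (d : ℕ → Ω → EuclideanSpace ℝ (Fin 2)) (S : ℕ → Ω → ℝ)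
    (α D : ℝ) (ω : Ω) : ℝ≥0∞ :=
  ∑' i : coopCluster d D ω, ENNReal.ofReal (S i ω) * ‖d i ω‖ₑ ^ (-α)

/-- Interference power received from the base stations outside the cooperation region. -/
def interferencePower {Ω : Type*} (d : ℕ → Ω → EuclideanSpace ℝ (Fin 2)) (G : ℕ → Ω → ℝ)
    (α D : ℝ) (ω : Ω) : ℝ≥0∞ :=
  ∑' j : ((coopCluster d D ω)ᶜ : Set ℕ), ENNReal.ofReal (G j ω) * ‖d j ω‖ₑ ^ (-α)

/-- Signal-to-interference ratio of the typical user, in `[0, ∞]`. -/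
def sir {Ω : Type*} (d : ℕ → Ω → EuclideanSpace ℝ (Fin 2)) (S G : ℕ → Ω → ℝ)
    (α D : ℝ) (ω : Ω) : ℝ≥0∞ :=
  usefulPower d S α D ω / interferencePower d G α D ω

/-- The average data rate `E[log (1 + SIR)]` (natural logarithm), in `[0, ∞]`. -/
def averageDataRate {Ω : Type*} [MeasurableSpace Ω] (P : Measure Ω)
    (d : ℕ → Ω → EuclideanSpace ℝ (Fin 2)) (S G : ℕ → Ω → ℝ) (α D : ℝ) : ℝ≥0∞ :=
  ∫⁻ ω, (ENNReal.log (1 + sir d S G α D ω)).toENNReal ∂P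

/-- The lower incomplete Beta function `B(t, a, b) = ∫_0^t s^(a-1) (1-s)^(b-1) ds`, for
`0 ≤ t < 1`, with the value `∞` where the integral diverges (that is, for `a ≤ 0 < t`). -/
def lowerIncBeta (t a b : ℝ) : ℝ≥0∞ :=
  ∫⁻ s in Set.Ioo 0 t, ENNReal.ofReal (s ^ (a - 1) * (1 - s) ^ (b - 1))

/-- The complementary (upper) incomplete Beta function
`B̄(t, a, b) = ∫_t^1 s^(a-1) (1-s)^(b-1) ds`, for `0 < t ≤ 1`. -/
def upperIncBeta (t a b : ℝ) : ℝ≥0∞ :=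
  ∫⁻ s in Set.Ioo t 1, ENNReal.ofReal (s ^ (a - 1) * (1 - s) ^ (b - 1))

/-- `H₁(x, K, α, D) = K x^(2/α) B̄(x/(x + D^α), 1 - 2/α, K + 2/α) + D² (1 - (1 + x D^(-α))^(-K))`. -/
def H1 (x K α D : ℝ) : EReal :=
  ((K * x ^ (2 / α) : ℝ) : EReal) *
      (upperIncBeta (x / (x + D ^ α)) (1 - 2 / α) (K + 2 / α) : EReal) +
    ((D ^ 2 * (1 - (1 + x * D ^ (-α)) ^ (-K)) : ℝ) : EReal)

/-- `H₂(x, α, D) = D² ((1 + x D^(-α))^(-1) - 1) + x^(2/α) B(x/(x + D^α), 1 - 2/α, 1 + 2/α)`.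
It is real for `2 < α` and equals `+∞` for `α = 2`, `0 < x`. -/
def H2 (x α D : ℝ) : EReal :=
  ((D ^ 2 * ((1 + x * D ^ (-α))⁻¹ - 1) : ℝ) : EReal) +
    ((x ^ (2 / α) : ℝ) : EReal) *
      (lowerIncBeta (x / (x + D ^ α)) (1 - 2 / α) (1 + 2 / α) : EReal)

end

/-! Write X for the useful power and Y for the interference. Frullani's formula gives log(1 + X/Y) =
∫₀^∞ (e^(-zY) - e^(-z(X+Y))) / z dz (`log_one_add_div_eq_lintegral`). By Tonelli, the rate therefore
depends only on the Laplace transforms of Y and X + Y. Both are Laplace functionals of a Poisson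
process with independent marks (S, G) (`IsHomogeneousPPP.laplace_marked`). Cooperating and
interfering stations lie in disjoint regions, so E e^(-z(X+Y)) factors as e^(-λ J₁) e^(-λ J₂), where
J₁ integrates 1 - (gamma transform) over the disc of radius D and J₂ does so over its complement.
This produces the product form of the integrand.

The plane integrals become Beta functions by the layer-cake formula: the level t of x/(x + ‖v‖^α) is
exceeded on a ball of area π x^(2/α) t^(-2/α) (1-t)^(2/α), and t₀ = x/(x + D^α) is the level at
which this ball is the cooperation disc. Levels on the two sides of t₀ contribute the different
terms of `H1` and `H2`.

For α > 2 the integrand is O(z^(2/α-1)) near 0 because J₁ is O(z^(2/α)), and O(z^(-1-2/α)) at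
infinity because J₂ grows at least like z^(2/α); hence the rate is finite. For α = 2, J₂ is infinite
and the integrand vanishes. Working in `[0, ∞]` throughout lets the identity be proved without
separating these cases. -/

/-! ### The exponential on `[0, ∞]` and the Poisson law -/

/-- The function `x ↦ e^(-x)` on `[0, ∞]`. -/
noncomputable def negExp (x : ℝ≥0∞) : ℝ≥0∞ := EReal.exp (-(x : EReal))

@[simp] lemma negExp_zero : negExp 0 = 1 := by simp [negExp]

@[simp] lemma negExp_top : negExp ∞ = 0 := by simp [negExp]

lemma negExp_add (x y : ℝ≥0∞) : negExp (x + y) = negExp x * negExp y := by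
  rw [negExp, EReal.coe_ennreal_add, EReal.neg_add, sub_eq_add_neg, EReal.exp_add, negExp, negExp]
  · left; simp
  · right; simp

lemma negExp_antitone : Antitone negExp := fun x y h => by
  unfold negExp
  exact EReal.exp_monotone (EReal.neg_le_neg_iff.2 (by exact_mod_cast h))

lemma negExp_le_one (x : ℝ≥0∞) : negExp x ≤ 1 := by
  simpa using negExp_antitone (zero_le (a := x))

lemma negExp_ne_top (x : ℝ≥0∞) : negExp x ≠ ∞ := ((negExp_le_one x).trans_lt (by simp)).ne

@[fun_prop]
lemma continuous_negExp : Continuous negExp :=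
  ENNReal.continuous_exp.comp (continuous_neg.comp continuous_coe_ennreal_ereal)

@[fun_prop]
lemma measurable_negExp : Measurable negExp := continuous_negExp.measurable

lemma negExp_ofReal {x : ℝ} (hx : 0 ≤ x) :
    negExp (ENNReal.ofReal x) = ENNReal.ofReal (Real.exp (-x)) := by
  rw [negExp, EReal.coe_ennreal_ofReal, max_eq_left hx, ← EReal.coe_neg, EReal.exp_coe]

lemma negExp_sum {ι : Type*} (s : Finset ι) (f : ι → ℝ≥0∞) :
    negExp (∑ i ∈ s, f i) = ∏ i ∈ s, negExp (f i) := by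
  classical
  induction s using Finset.induction_on with
  | empty => simp
  | insert i s hi ih => rw [Finset.sum_insert hi, Finset.prod_insert hi, negExp_add, ih]

lemma negExp_natCast_mul (n : ℕ) (a : ℝ≥0∞) : negExp (n * a) = negExp a ^ n := by
  induction n with
  | zero => simp
  | succ n ih => rw [Nat.cast_succ, add_mul, one_mul, negExp_add, ih, pow_succ]

/-- Any factor in `[0, 1]`, including 0, is an exponential; this turns a product of mark averages
back into a Laplace functional of the points alone. -/
lemma negExp_neg_log {y : ℝ≥0∞} (hy : y ≤ 1) : negExp (-ENNReal.log y).toENNReal = y := by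
  rw [negExp, EReal.coe_toENNReal (by simpa using hy), neg_neg, ENNReal.exp_log]

lemma tendsto_negExp_sum (f : ℕ → ℝ≥0∞) :
    Filter.Tendsto (fun n => ∏ i ∈ Finset.range n, negExp (f i)) Filter.atTop
      (nhds (negExp (∑' i, f i))) := by
  simp_rw [← negExp_sum]
  exact (continuous_negExp.tendsto _).comp ENNReal.summable.hasSum.tendsto_sum_nat

/-- With q = e^(-a), this is the exponential series for r q. It also covers a = ∞, where q = 0 and
the conventions 0 * ∞ = 0 and 0 ^ 0 = 1 agree. -/
lemma lintegral_negExp_poissonMeasure (r : ℝ≥0) (a : ℝ≥0∞) :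
    ∫⁻ n : ℕ, negExp (n * a) ∂(poissonMeasure r) = negExp (r * (1 - negExp a)) := by
  obtain ⟨q, hq⟩ : ∃ q : ℝ≥0, (q : ℝ≥0∞) = negExp a := ⟨_, ENNReal.coe_toNNReal (negExp_ne_top a)⟩
  have hq1 : q ≤ 1 := by
    have := negExp_le_one a
    rw [← hq] at this
    exact_mod_cast this
  have h1 : ∀ n : ℕ, negExp (n * a) = ENNReal.ofReal ((q : ℝ) ^ n) := fun n => by
    rw [negExp_natCast_mul, ← hq, ENNReal.ofReal_pow q.coe_nonneg, ENNReal.ofReal_coe_nnreal]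
  have h2 : (r : ℝ≥0∞) * (1 - negExp a) = ENNReal.ofReal (r * (1 - q)) := by
    rw [ENNReal.ofReal_mul r.coe_nonneg, ENNReal.ofReal_sub _ q.coe_nonneg, ← hq]
    simp
  rw [h2, negExp_ofReal (mul_nonneg r.coe_nonneg (sub_nonneg.2 (by exact_mod_cast hq1))), lintegral_countable']
  simp_rw [h1, poissonMeasure_singleton]
  have h3 : ∀ n : ℕ, ENNReal.ofReal ((q : ℝ) ^ n) *
      ENNReal.ofReal (Real.exp (-r) * r ^ n / n.factorial) =
      ENNReal.ofReal (Real.exp (-r) * ((r * q : ℝ) ^ n / n.factorial)) := fun n => by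
    rw [← ENNReal.ofReal_mul (by positivity)]
    congr 1
    rw [mul_pow]; ring
  simp_rw [h3]
  have hs : HasSum (fun n : ℕ => Real.exp (-r) * ((r * q : ℝ) ^ n / n.factorial))
      (Real.exp (-r) * Real.exp (r * q)) := by
    rw [Real.exp_eq_exp_ℝ]
    exact (NormedSpace.expSeries_div_hasSum_exp (r * q : ℝ)).mul_left _
  rw [← ENNReal.ofReal_tsum_of_nonneg (fun n => by positivity) hs.summable, hs.tsum_eq,
    ← Real.exp_add]
  congr 2; ring

/-! ### Laplace functionals of plain and marked Poisson processes -/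

section PoissonProcess

variable {Ω : Type*} [MeasurableSpace Ω] {P : Measure Ω} {lam : ℝ}
  {d : ℕ → Ω → EuclideanSpace ℝ (Fin 2)}

omit [MeasurableSpace Ω] in
lemma tsum_indicator_eq_pointCount (d : ℕ → Ω → EuclideanSpace ℝ (Fin 2))
    (B : Set (EuclideanSpace ℝ (Fin 2))) (ω : Ω) :
    ∑' i, B.indicator 1 (d i ω) = ((pointCount d B ω : ℕ∞) : ℝ≥0∞) := by
  rw [pointCount, ← Measure.count_apply (MeasurableSet.of_discrete),
    ← lintegral_indicator_one MeasurableSet.of_discrete, lintegral_count]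
  rfl

lemma IsHomogeneousPPP.lintegral_negExp_pointCount (hd : IsHomogeneousPPP P lam d)
    {B : Set (EuclideanSpace ℝ (Fin 2))} (hB : MeasurableSet B) (hB' : volume B ≠ ∞) (a : ℝ≥0∞) :
    ∫⁻ ω, negExp (a * ((pointCount d B ω : ℕ∞) : ℝ≥0∞)) ∂P =
      negExp (ENNReal.ofReal lam * volume B * (1 - negExp a)) := by
  have h := hd.poisson B hB hB'
  have hm : Measurable (fun u : ℕ∞ => negExp (a * (u : ℝ≥0∞))) := by fun_prop
  rw [← lintegral_map' (f := fun u : ℕ∞ => negExp (a * (u : ℝ≥0∞))) hm.aemeasurable h.aemeasurable,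
    h.map_eq, lintegral_map hm (by fun_prop)]
  simp_rw [mul_comm a]
  have := lintegral_negExp_poissonMeasure (lam.toNNReal * (volume B).toNNReal) a
  simp only [ENNReal.coe_mul, ENNReal.coe_toNNReal hB'] at this
  exact this

/-- The Laplace functional of a homogeneous Poisson point process at a simple function. -/
lemma IsHomogeneousPPP.laplace_simpleFunc (hd : IsHomogeneousPPP P lam d)
    (g : SimpleFunc (EuclideanSpace ℝ (Fin 2)) ℝ≥0∞)
    (hg : ∀ a, a ≠ 0 → volume (g ⁻¹' {a}) ≠ ∞) :
    ∫⁻ ω, negExp (∑' i, g (d i ω)) ∂P =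
      negExp (ENNReal.ofReal lam * ∫⁻ x, (1 - negExp (g x))) := by
  -- The value 0 is discarded: its level set may have infinite area, and it contributes nothing to
  -- either side. The remaining level sets are disjoint of finite area, so their counts are
  -- independent Poisson variables.
  set s : Finset ℝ≥0∞ := g.range.filter (· ≠ 0) with hs
  have hmem : ∀ a : s, (a : ℝ≥0∞) ≠ 0 := fun a => (Finset.mem_filter.1 a.2).2
  have hsum : ∀ ω, ∑' i, g (d i ω) =
      ∑ a : s, (a : ℝ≥0∞) * ((pointCount d (g ⁻¹' {(a : ℝ≥0∞)}) ω : ℕ∞) : ℝ≥0∞) := fun ω => by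
    have hm : Measurable (fun i => d i ω) := measurable_of_countable _
    have : ∑' i, g (d i ω) = g.lintegral (Measure.count.map (fun i => d i ω)) := by
      rw [← SimpleFunc.lintegral_eq_lintegral, lintegral_map g.measurable hm, lintegral_count]
    rw [this, SimpleFunc.lintegral, Finset.sum_coe_sort s (fun a : ℝ≥0∞ =>
      a * ((pointCount d (g ⁻¹' {(a : ℝ≥0∞)}) ω : ℕ∞) : ℝ≥0∞)), hs, Finset.sum_filter_of_ne]
    · refine Finset.sum_congr rfl fun a _ => ?_
      rw [Measure.map_apply hm (g.measurableSet_fiber a),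
        Measure.count_apply MeasurableSet.of_discrete]
      rfl
    · intro a _ h h0
      simp [h0] at h
  have hint : ∫⁻ x, (1 - negExp (g x)) =
      ∑ a : s, (1 - negExp (a : ℝ≥0∞)) * volume (g ⁻¹' {(a : ℝ≥0∞)}) := by
    have : ∫⁻ x, (1 - negExp (g x)) = (g.map (fun a => 1 - negExp a)).lintegral volume := by
      rw [← SimpleFunc.lintegral_eq_lintegral]; rfl
    rw [this, SimpleFunc.map_lintegral, Finset.sum_coe_sort s (fun a : ℝ≥0∞ =>
      (1 - negExp a) * volume (g ⁻¹' {(a : ℝ≥0∞)})), hs, Finset.sum_filter_of_ne]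
    intro a _ h h0
    simp [h0] at h
  have hind : iIndepFun (fun a : s => pointCount d (g ⁻¹' {(a : ℝ≥0∞)})) P := by
    have e := s.equivFin
    have h := hd.indep _ (fun k => g ⁻¹' {((e.symm k : s) : ℝ≥0∞)})
      (fun k => g.measurableSet_fiber _)
      (fun k => hg _ (hmem (e.symm k)))
      (fun k l hkl => (Set.disjoint_singleton.2 fun h => hkl (e.symm.injective
        (Subtype.ext h))).preimage _)
    have := h.precomp e.injective
    simpa using this
  simp_rw [hsum, negExp_sum]
  rw [lintegral_prod_eq_prod_lintegral_of_indepFun Finset.univ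
    (fun (a : s) ω => negExp ((a : ℝ≥0∞) * ((pointCount d (g ⁻¹' {(a : ℝ≥0∞)}) ω : ℕ∞) : ℝ≥0∞)))
    (hind.comp (fun (a : s) u => negExp ((a : ℝ≥0∞) * ((u : ℕ∞) : ℝ≥0∞)))
      (fun a => by fun_prop))]
  · rw [hint, Finset.mul_sum, negExp_sum]
    refine Finset.prod_congr rfl fun a _ => ?_
    rw [hd.lintegral_negExp_pointCount (g.measurableSet_fiber _)
      (hg _ (hmem a))]
    congr 1
    ring
  · intro a
    simp_rw [← tsum_indicator_eq_pointCount]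
    exact measurable_negExp.comp ((Measurable.tsum fun i =>
      (measurable_one.indicator (g.measurableSet_fiber _)).comp (hd.measurable i)).const_mul _)

/-- The Laplace functional of a homogeneous Poisson point process. -/
lemma IsHomogeneousPPP.laplace [IsProbabilityMeasure P] (hd : IsHomogeneousPPP P lam d)
    {f : EuclideanSpace ℝ (Fin 2) → ℝ≥0∞} (hf : Measurable f) :
    ∫⁻ ω, negExp (∑' i, f (d i ω)) ∂P =
      negExp (ENNReal.ofReal lam * ∫⁻ x, (1 - negExp (f x))) := by
  -- Restricting to growing balls gives the nonzero level sets finite area while keeping the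
  -- approximation monotone.
  set g : ℕ → SimpleFunc (EuclideanSpace ℝ (Fin 2)) ℝ≥0∞ := fun n =>
    (SimpleFunc.eapprox f n).restrict (Metric.ball 0 n) with hgdef
  have hgapp : ∀ n x, g n x = (Metric.ball 0 (n : ℝ)).indicator (SimpleFunc.eapprox f n) x :=
    fun n x => SimpleFunc.restrict_apply _ measurableSet_ball x
  have hmono : Monotone g := by
    intro m n hmn x
    rw [hgapp, hgapp]
    refine (Set.indicator_le_indicator_of_subset (Metric.ball_subset_ball (by exact_mod_cast hmn))
      (fun _ => zero_le) x).trans (Set.indicator_le_indicator ?_)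
    exact SimpleFunc.monotone_eapprox f hmn x
  have htend : ∀ x, Filter.Tendsto (fun n => g n x) Filter.atTop (nhds (f x)) := fun x => by
    have h1 : Filter.Tendsto (fun n => SimpleFunc.eapprox f n x) Filter.atTop (nhds (f x)) := by
      rw [← SimpleFunc.iSup_eapprox_apply hf x]
      exact tendsto_atTop_iSup fun m n h => SimpleFunc.monotone_eapprox f h x
    refine h1.congr' ?_
    obtain ⟨N, hN⟩ := exists_nat_gt ‖x‖
    filter_upwards [Filter.eventually_ge_atTop N] with n hn
    rw [hgapp, Set.indicator_of_mem]
    simpa using hN.trans_le (by exact_mod_cast hn)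
  have hsimple : ∀ n, ∫⁻ ω, negExp (∑' i, g n (d i ω)) ∂P =
      negExp (ENNReal.ofReal lam * ∫⁻ x, (1 - negExp (g n x))) := fun n => by
    refine hd.laplace_simpleFunc (g n) fun a ha => ne_top_of_le_ne_top
      (measure_ball_lt_top (μ := volume) (x := (0 : EuclideanSpace ℝ (Fin 2))) (r := n)).ne
      (measure_mono ?_)
    intro x hx
    by_contra hxB
    apply ha
    rw [Set.mem_preimage, Set.mem_singleton_iff, hgapp, Set.indicator_of_notMem hxB] at hx
    exact hx.symm
  refine tendsto_nhds_unique (f := fun n => ∫⁻ ω, negExp (∑' i, g n (d i ω)) ∂P)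
    (l := Filter.atTop) ?_ ?_
  · refine tendsto_lintegral_of_dominated_convergence (fun _ => 1) (fun n => ?_)
      (fun n => .of_forall fun ω => negExp_le_one _) (by simp) (.of_forall fun ω => ?_)
    · exact measurable_negExp.comp (Measurable.tsum fun i =>
        (g n).measurable.comp (hd.measurable i))
    · refine (continuous_negExp.tendsto _).comp ?_
      simp_rw [← lintegral_count]
      exact lintegral_tendsto_of_tendsto_of_monotone (fun n => (measurable_of_countable _).aemeasurable)
        (.of_forall fun i m n h => hmono h _) (.of_forall fun i => htend _)
  · simp_rw [hsimple]
    refine (continuous_negExp.tendsto _).comp (ENNReal.Tendsto.const_mul ?_ (Or.inr (by simp)))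
    refine lintegral_tendsto_of_tendsto_of_monotone (fun n => ?_) (.of_forall fun x m n h => ?_)
      (.of_forall fun x => ?_)
    · have := (g n).measurable
      fun_prop
    · exact tsub_le_tsub_left (negExp_antitone (hmono h _)) _
    · exact ENNReal.Tendsto.sub tendsto_const_nhds ((continuous_negExp.tendsto _).comp (htend x))
        (Or.inl (by simp))

end PoissonProcess

/-- The Laplace functional of an independently marked homogeneous Poisson point process. -/
lemma IsHomogeneousPPP.laplace_marked {Ω 𝓜 : Type*} [MeasurableSpace Ω] [MeasurableSpace 𝓜]
    {P : Measure Ω} [IsProbabilityMeasure P] {lam : ℝ} {d : ℕ → Ω → EuclideanSpace ℝ (Fin 2)}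
    (hd : IsHomogeneousPPP P lam d) {M : ℕ → Ω → 𝓜} (hM : ∀ i, AEMeasurable (M i) P)
    (hMi : iIndepFun M P) (hindep : IndepFun (fun ω i => d i ω) (fun ω i => M i ω) P)
    {h : EuclideanSpace ℝ (Fin 2) → 𝓜 → ℝ≥0∞} (hh : Measurable (Function.uncurry h))
    {φ : EuclideanSpace ℝ (Fin 2) → ℝ≥0∞}
    (hφ : ∀ i x, ∫⁻ ω, negExp (h x (M i ω)) ∂P = φ x) :
    ∫⁻ ω, negExp (∑' i, h (d i ω) (M i ω)) ∂P =
      negExp (ENNReal.ofReal lam * ∫⁻ x, (1 - φ x)) := by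
  have hhx : ∀ x, Measurable (h x) := fun x => hh.comp measurable_prodMk_left
  have hφ1 : ∀ x, φ x ≤ 1 := fun x => by
    rw [← hφ 0 x]
    exact (lintegral_mono fun _ => negExp_le_one _).trans (by simp)
  have hφm : Measurable φ := by
    have : φ = fun x => ∫⁻ m, negExp (h x m) ∂(P.map (M 0)) := by
      funext x
      rw [← hφ 0 x]
      exact (lintegral_map' (measurable_negExp.comp (hhx x)).aemeasurable (hM 0)).symm
    rw [this]
    exact (measurable_negExp.comp hh).lintegral_prod_right'
  have hdm : AEMeasurable (fun ω i => d i ω) P :=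
    aemeasurable_pi_lambda _ fun i => (hd.measurable i).aemeasurable
  have hMm : AEMeasurable (fun ω i => M i ω) P := aemeasurable_pi_lambda _ hM
  set F : (ℕ → EuclideanSpace ℝ (Fin 2)) → (ℕ → 𝓜) → ℝ≥0∞ :=
    fun x m => negExp (∑' i, h (x i) (m i)) with hF
  have hFm : Measurable (Function.uncurry F) := by
    refine measurable_negExp.comp (Measurable.tsum fun i => ?_)
    have : Measurable fun q : (ℕ → EuclideanSpace ℝ (Fin 2)) × (ℕ → 𝓜) => (q.1 i, q.2 i) := by
      fun_prop
    exact hh.comp this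
  -- For frozen positions, averaging the independent marks gives ∏ φ(x i), which is written as the
  -- exponential of a sum so that `laplace` applies to -log φ.
  have hinner : ∀ x, ∫⁻ m, F x m ∂(P.map fun ω i => M i ω) =
      negExp (∑' i, (-ENNReal.log (φ (x i))).toENNReal) := fun x => by
    refine (lintegral_map' (hFm.comp measurable_prodMk_left).aemeasurable hMm).trans ?_
    refine tendsto_nhds_unique
      (f := fun n => ∫⁻ ω, ∏ i ∈ Finset.range n, negExp (h (x i) (M i ω)) ∂P)
      (l := Filter.atTop) ?_ ?_
    · refine tendsto_lintegral_of_dominated_convergence' (fun _ => 1) (fun n => ?_)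
        (fun n => .of_forall fun ω => ?_) (by simp) (.of_forall fun ω => tendsto_negExp_sum _)
      · exact Finset.aemeasurable_fun_prod _ fun i _ =>
          (measurable_negExp.comp (hhx _)).comp_aemeasurable (hM i)
      · exact Finset.prod_le_one' fun i _ => negExp_le_one _
    -- The marks are only a.e. measurable; measurable versions are used to factor the expectation.
    · have hM' : ∀ i, (M i) =ᵐ[P] (hM i).mk := fun i => (hM i).ae_eq_mk
      have hprod : ∀ n, ∫⁻ ω, ∏ i ∈ Finset.range n, negExp (h (x i) (M i ω)) ∂P =
          ∏ i ∈ Finset.range n, negExp (-ENNReal.log (φ (x i))).toENNReal := fun n => by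
        have h1 : ∀ᵐ ω ∂P, ∀ i, M i ω = (hM i).mk (M i) ω := ae_all_iff.2 hM'
        rw [lintegral_congr_ae (g := fun ω => ∏ i ∈ Finset.range n,
          negExp (h (x i) ((hM i).mk (M i) ω)))
          (by filter_upwards [h1] with ω hω; simp_rw [← hω])]
        rw [lintegral_prod_eq_prod_lintegral_of_indepFun (Finset.range n)
          (fun i ω => negExp (h (x i) ((hM i).mk (M i) ω)))
          ((hMi.congr hM').comp (fun i m => negExp (h (x i) m))
            (fun i => measurable_negExp.comp (hhx _)))
          (fun i => (measurable_negExp.comp (hhx _)).comp (hM i).measurable_mk)]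
        refine Finset.prod_congr rfl fun i _ => ?_
        rw [negExp_neg_log (hφ1 _), ← hφ i]
        exact lintegral_congr_ae (by filter_upwards [h1] with ω hω; rw [← hω])
      simp_rw [hprod]
      exact tendsto_negExp_sum _
  have hjoint : ∫⁻ ω, negExp (∑' i, h (d i ω) (M i ω)) ∂P =
      ∫⁻ ω, negExp (∑' i, (-ENNReal.log (φ (d i ω))).toENNReal) ∂P := by
    calc ∫⁻ ω, negExp (∑' i, h (d i ω) (M i ω)) ∂P
        = ∫⁻ q, Function.uncurry F q ∂(P.map fun ω => ((fun i => d i ω), (fun i => M i ω))) :=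
          (lintegral_map' hFm.aemeasurable (hdm.prodMk hMm)).symm
      _ = ∫⁻ x, ∫⁻ m, F x m ∂(P.map fun ω i => M i ω) ∂(P.map fun ω i => d i ω) := by
          rw [hindep.map_prod_eq_prod_map_map hdm hMm]
          exact lintegral_prod _ hFm.aemeasurable
      _ = _ := by
          refine (lintegral_map' hFm.lintegral_prod_right'.aemeasurable hdm).trans ?_
          exact lintegral_congr fun ω => hinner _
  have hlog : Measurable fun x => (-ENNReal.log (φ x)).toENNReal := by fun_prop
  rw [hjoint, hd.laplace hlog]
  simp_rw [negExp_neg_log (hφ1 _)]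

/-! ### Gamma transforms and the Frullani formula -/

/-- The Laplace transform of the gamma distribution. -/
lemma lintegral_negExp_gammaMeasure {a r c : ℝ} (ha : 0 < a) (hr : 0 < r) (hc : 0 ≤ c) :
    ∫⁻ s, negExp (ENNReal.ofReal s * ENNReal.ofReal c) ∂(gammaMeasure a r) =
      ENNReal.ofReal ((1 + c / r) ^ (-a)) := by
  have hm : Measurable (gammaPDF a r) := (measurable_gammaPDFReal a r).ennreal_ofReal
  rw [gammaMeasure, lintegral_withDensity_eq_lintegral_mul _ hm (by fun_prop)]
  have hrc : 0 < r + c := by positivity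
  have hpt : ∀ s, (gammaPDF a r * fun s => negExp (ENNReal.ofReal s * ENNReal.ofReal c)) s =
      ENNReal.ofReal ((1 + c / r) ^ (-a)) * gammaPDF a (r + c) s := fun s => by
    rcases lt_or_ge s 0 with hs | hs
    · simp [gammaPDF_of_neg hs]
    · rw [Pi.mul_apply, gammaPDF_of_nonneg hs, gammaPDF_of_nonneg hs, ← ENNReal.ofReal_mul hs,
        negExp_ofReal (by positivity), ← ENNReal.ofReal_mul' (by positivity),
        ← ENNReal.ofReal_mul (by positivity)]
      congr 1
      have h1 : (1 + c / r) = (r + c) / r := by field_simp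
      have h2 : Real.exp (-((r + c) * s)) = Real.exp (-(r * s)) * Real.exp (-(s * c)) := by
        rw [← Real.exp_add]; congr 1; ring
      have h3 : 0 < Real.Gamma a := Real.Gamma_pos_of_pos ha
      rw [h1, h2, Real.rpow_neg (by positivity), Real.div_rpow hrc.le hr.le]
      have h4 : (0 : ℝ) < (r + c) ^ a := by positivity
      have h5 : (0 : ℝ) < r ^ a := by positivity
      field_simp
  have hm' : Measurable (gammaPDF a (r + c)) := (measurable_gammaPDFReal a _).ennreal_ofReal
  simp_rw [hpt]
  rw [lintegral_const_mul _ hm',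
    lintegral_gammaPDF_eq_one ha hrc, mul_one]

lemma setLIntegral_Ioc_zero_inv {c : ℝ} (hc : 0 < c) :
    ∫⁻ u in Set.Ioc 0 c, ENNReal.ofReal u⁻¹ = ∞ := by
  by_contra h
  have h1 : IntegrableOn (fun u : ℝ => u⁻¹) (Set.Ioc 0 c) := by
    refine (lintegral_ofReal_ne_top_iff_integrable (by fun_prop) ?_).1 h
    filter_upwards [ae_restrict_mem measurableSet_Ioc] with u hu
    exact inv_nonneg.2 hu.1.le
  have h2 := (intervalIntegrable_iff_integrableOn_Ioc_of_le hc.le).2 h1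
  simp [hc.ne, hc.le, intervalIntegrable_inv_iff] at h2

lemma setLIntegral_Ioi_zero_exp_neg_mul {u : ℝ} (hu : 0 < u) :
    ∫⁻ z in Set.Ioi 0, ENNReal.ofReal (Real.exp (-(z * u))) = ENNReal.ofReal u⁻¹ := by
  have h1 : ∀ z : ℝ, -(z * u) = (-u) * z := fun z => by ring
  simp_rw [h1]
  rw [← ofReal_integral_eq_lintegral_ofReal (integrableOn_exp_mul_Ioi (by linarith) 0)
    (.of_forall fun z => (Real.exp_pos _).le), integral_exp_mul_Ioi (by linarith) 0]
  congr 1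
  simp

lemma setLIntegral_Ioc_exp_neg_mul {z x y : ℝ} (hz : 0 < z) (hx : 0 ≤ x) :
    ∫⁻ u in Set.Ioc y (x + y), ENNReal.ofReal (Real.exp (-(z * u))) =
      ENNReal.ofReal ((Real.exp (-(z * y)) - Real.exp (-(z * (x + y)))) / z) := by
  have hc : Continuous fun u : ℝ => Real.exp (-(z * u)) := by fun_prop
  rw [← ofReal_integral_eq_lintegral_ofReal
    (hc.integrableOn_Icc.mono_set Set.Ioc_subset_Icc_self)
    (.of_forall fun z => (Real.exp_pos _).le), ← intervalIntegral.integral_of_le (by linarith)]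
  congr 1
  have hd : ∀ u ∈ Set.uIcc y (x + y),
      HasDerivAt (fun u => -(Real.exp (-(z * u)) / z)) (Real.exp (-(z * u))) u := fun u _ => by
    have h1 : HasDerivAt (fun u => -(z * u)) (-(z * 1)) u := ((hasDerivAt_id u).const_mul z).neg
    convert! (h1.exp.div_const z).neg using 1
    field_simp
  rw [intervalIntegral.integral_eq_sub_of_hasDerivAt hd (hc.intervalIntegrable _ _)]
  ring

/-- A Frullani representation of `log (1 + X / Y)`, valid on `[0, ∞]`. -/
lemma log_one_add_div_eq_lintegral (X Y : ℝ≥0∞) :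
    (ENNReal.log (1 + X / Y)).toENNReal =
      ∫⁻ z in Set.Ioi (0 : ℝ), (negExp (ENNReal.ofReal z * Y) -
        negExp (ENNReal.ofReal z * (X + Y))) / ENNReal.ofReal z := by
  have hpos : ∀ z ∈ Set.Ioi (0 : ℝ), ENNReal.ofReal z ≠ 0 := fun z hz => by simpa using hz
  -- Here X / ∞ = 0 even for X = ∞, and both exponentials vanish for z > 0.
  by_cases hY : Y = ∞
  · subst hY
    rw [setLIntegral_congr_fun (g := fun _ => 0) measurableSet_Ioi
      (fun z hz => by simp [ENNReal.mul_top (hpos z hz)])]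
    simp
  lift Y to ℝ≥0 using hY
  by_cases hX : X = ∞
  · subst hX
    have h1 : (∞ / (Y : ℝ≥0∞)) = ∞ := ENNReal.top_div_of_ne_top (by simp)
    rw [h1]
    simp only [add_top, ENNReal.log_top, EReal.toENNReal_top, top_add]
    symm
    rw [eq_top_iff]
    calc ∞ = negExp Y * ∫⁻ u in Set.Ioc (0 : ℝ) 1, ENNReal.ofReal u⁻¹ := by
          rw [setLIntegral_Ioc_zero_inv one_pos, ENNReal.mul_top]
          simp [negExp]
      _ = ∫⁻ u in Set.Ioc (0 : ℝ) 1, negExp Y * ENNReal.ofReal u⁻¹ :=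
          (lintegral_const_mul _ (by fun_prop)).symm
      _ ≤ ∫⁻ z in Set.Ioc (0 : ℝ) 1, (negExp (ENNReal.ofReal z * Y) -
            negExp (ENNReal.ofReal z * ∞)) / ENNReal.ofReal z := by
          refine setLIntegral_mono' measurableSet_Ioc fun z hz => ?_
          rw [ENNReal.mul_top (hpos z hz.1), negExp_top, tsub_zero, div_eq_mul_inv,
            ENNReal.ofReal_inv_of_pos hz.1]
          gcongr
          refine negExp_antitone (mul_le_of_le_one_left zero_le ?_)
          simpa using hz.2
      _ ≤ _ := lintegral_mono_set Set.Ioc_subset_Ioi_self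
  lift X to ℝ≥0 using hX
  -- The quotient is the integral of e^(-zu) over u between Y and X + Y; exchanging the integrals
  -- leaves ∫ du/u, which is the logarithm.
  have hint : ∀ z ∈ Set.Ioi (0 : ℝ), (negExp (ENNReal.ofReal z * Y) -
      negExp (ENNReal.ofReal z * (X + Y))) / ENNReal.ofReal z =
      ∫⁻ u in Set.Ioc (Y : ℝ) (X + Y), ENNReal.ofReal (Real.exp (-(z * u))) := fun z hz => by
    have hz0 : (0 : ℝ) < z := hz
    have e1 : ENNReal.ofReal z * Y = ENNReal.ofReal (z * Y) := by
      rw [ENNReal.ofReal_mul hz0.le, ENNReal.ofReal_coe_nnreal]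
    have e2 : ENNReal.ofReal z * (X + Y) = ENNReal.ofReal (z * (X + Y)) := by
      rw [ENNReal.ofReal_mul hz0.le, ENNReal.ofReal_add X.coe_nonneg Y.coe_nonneg,
        ENNReal.ofReal_coe_nnreal, ENNReal.ofReal_coe_nnreal]
    rw [e1, e2, negExp_ofReal (by positivity), negExp_ofReal (by positivity),
      ← ENNReal.ofReal_sub _ (Real.exp_pos _).le, ← ENNReal.ofReal_div_of_pos hz0,
      setLIntegral_Ioc_exp_neg_mul hz0 X.coe_nonneg]
  rw [setLIntegral_congr_fun measurableSet_Ioi hint, lintegral_lintegral_swap (by fun_prop)]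
  rw [setLIntegral_congr_fun (g := fun u => ENNReal.ofReal u⁻¹) measurableSet_Ioc
    (fun u hu => setLIntegral_Ioi_zero_exp_neg_mul (Y.coe_nonneg.trans_lt hu.1))]
  -- At Y = 0 the integral of 1/u diverges if X > 0, matching X / 0 = ∞; if X = 0 the range is
  -- empty, matching 0 / 0 = 0.
  rcases eq_or_ne Y 0 with rfl | hY
  · rcases eq_or_ne X 0 with rfl | hX
    · simp
    · have hX0 : (0 : ℝ) < X := by positivity
      have h2 : (X : ℝ≥0∞) / 0 = ∞ := ENNReal.div_zero (by simpa using hX)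
      simp only [NNReal.coe_zero, add_zero, setLIntegral_Ioc_zero_inv hX0, ENNReal.coe_zero, h2]
      simp
  · have hY0 : (0 : ℝ) < Y := by positivity
    have hle : (Y : ℝ) ≤ X + Y := by simp
    have hcont : ContinuousOn (fun u : ℝ => u⁻¹) (Set.Icc (Y : ℝ) (X + Y)) :=
      continuousOn_inv₀.mono fun u hu => (hY0.trans_le hu.1).ne'
    rw [← ofReal_integral_eq_lintegral_ofReal
      (hcont.integrableOn_Icc.mono_set Set.Ioc_subset_Icc_self)
      (by filter_upwards [ae_restrict_mem measurableSet_Ioc] with u hu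
          exact inv_nonneg.2 (hY0.trans hu.1).le),
      ← intervalIntegral.integral_of_le hle, integral_inv_of_pos hY0 (by positivity)]
    have h3 : (1 : ℝ≥0∞) + X / Y = ENNReal.ofReal ((X + Y) / Y) := by
      rw [ENNReal.ofReal_div_of_pos hY0, ENNReal.ofReal_add X.coe_nonneg Y.coe_nonneg,
        ENNReal.ofReal_coe_nnreal, ENNReal.ofReal_coe_nnreal, ENNReal.add_div,
        ENNReal.div_self (by simpa using hY) (by simp), add_comm]
    rw [h3, ENNReal.log_ofReal_of_pos (by positivity), EReal.real_coe_toENNReal]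

/-! ### Plane integrals as incomplete Beta functions, and their growth -/

section Plane

variable {x α D K : ℝ}

lemma lt_div_add_rpow_iff (hx : 0 < x) (hα : 0 < α) {t r : ℝ} (ht : 0 < t) (ht1 : t < 1)
    (hr : 0 ≤ r) : t < x / (x + r ^ α) ↔ r < (x * (1 - t) / t) ^ (1 / α) := by
  have h1 : 0 ≤ r ^ α := by positivity
  have h2 : 0 ≤ x * (1 - t) / t := by
    have : 0 ≤ 1 - t := by linarith
    positivity
  rw [lt_div_iff₀ (by positivity), one_div, Real.lt_rpow_inv_iff_of_pos hr h2 hα, lt_div_iff₀ ht]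
  constructor <;> intro h <;> nlinarith

lemma div_add_rpow_le_one (hx : 0 < x) {r : ℝ} (hr : 0 ≤ r) : x / (x + r ^ α) ≤ 1 := by
  have h1 : 0 ≤ r ^ α := by positivity
  rw [div_le_one (by positivity)]
  linarith

lemma setOf_lt_div_add_norm_rpow (hx : 0 < x) (hα : 0 < α) {t : ℝ} (ht : 0 < t) (ht1 : t < 1) :
    {v : EuclideanSpace ℝ (Fin 2) | t < x / (x + ‖v‖ ^ α)} =
      Metric.ball 0 ((x * (1 - t) / t) ^ (1 / α)) := by
  ext v
  rw [Set.mem_ofPred_eq, lt_div_add_rpow_iff hx hα ht ht1 (norm_nonneg v), mem_ball_zero_iff]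

lemma volume_setOf_lt_div_add_norm_rpow (hx : 0 < x) (hα : 0 < α) {t : ℝ} (ht : 0 < t)
    (ht1 : t < 1) :
    volume {v : EuclideanSpace ℝ (Fin 2) | t < x / (x + ‖v‖ ^ α)} =
      ENNReal.ofReal (Real.pi * x ^ (2 / α) * (t ^ (-(2 / α)) * (1 - t) ^ (2 / α))) := by
  have h0 : 0 ≤ 1 - t := by linarith
  have h2 : 0 ≤ x * (1 - t) / t := by positivity
  rw [setOf_lt_div_add_norm_rpow hx hα ht ht1, EuclideanSpace.volume_ball_fin_two,
    ← ENNReal.ofReal_pow (by positivity), ← ENNReal.ofReal_mul (by positivity)]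
  congr 1
  rw [← Real.rpow_natCast, ← Real.rpow_mul h2, Real.div_rpow (by positivity) ht.le,
    Real.mul_rpow hx.le h0, Real.rpow_neg ht.le]
  have : 1 / α * ((2 : ℕ) : ℝ) = 2 / α := by push_cast; ring
  rw [this]
  have : (0 : ℝ) < t ^ (2 / α) := by positivity
  field_simp

lemma measurable_div_add_norm_rpow :
    Measurable fun v : EuclideanSpace ℝ (Fin 2) => x / (x + ‖v‖ ^ α) := by fun_prop

/-- The absolute value keeps the density nonnegative and, as K ≥ 1, continuous on the whole line, as
the layer-cake formula is applied over all t > 0; only levels t ≤ 1 matter. -/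
lemma intervalIntegral_one_sub_rpow (hK : 1 ≤ K) {u : ℝ} (hu : 0 ≤ u) (hu1 : u ≤ 1) :
    ∫ t in (0 : ℝ)..u, K * |1 - t| ^ (K - 1) = 1 - (1 - u) ^ K := by
  have h1 : ∀ t ∈ Set.uIcc 0 u,
      HasDerivAt (fun t : ℝ => -(1 - t) ^ K) (K * |1 - t| ^ (K - 1)) t := fun t ht => by
    rw [Set.uIcc_of_le hu] at ht
    rw [abs_of_nonneg (by linarith [ht.2])]
    have := (((hasDerivAt_id t).const_sub 1).rpow_const (p := K) (Or.inr hK)).neg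
    convert! this using 1
    simp
  rw [intervalIntegral.integral_eq_sub_of_hasDerivAt h1]
  · simp
    ring
  · refine Continuous.intervalIntegrable ?_ _ _
    exact continuous_const.mul ((by fun_prop : Continuous fun t : ℝ => |1 - t|).rpow_const
      fun _ => Or.inr (by linarith))

/-- The layer-cake representation of the integral of `1 - (1 + x ‖v‖ ^ (-α)) ^ (-K)`. -/
lemma lintegral_one_sub_rpow_eq_layercake (hx : 0 < x) (hK : 1 ≤ K)
    (μ : Measure (EuclideanSpace ℝ (Fin 2))) :
    ∫⁻ v, (1 - ENNReal.ofReal ((1 - x / (x + ‖v‖ ^ α)) ^ K)) ∂μ =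
      ∫⁻ t in Set.Ioo 0 1, μ {v | t < x / (x + ‖v‖ ^ α)} *
        ENNReal.ofReal (K * (1 - t) ^ (K - 1)) := by
  have hcont : Continuous fun t : ℝ => K * |1 - t| ^ (K - 1) :=
    continuous_const.mul ((by fun_prop : Continuous fun t : ℝ => |1 - t|).rpow_const
      fun _ => Or.inr (by linarith))
  have h := lintegral_comp_eq_lintegral_meas_lt_mul (f := fun v => x / (x + ‖v‖ ^ α))
    (g := fun t => K * |1 - t| ^ (K - 1)) μ (.of_forall fun v => by positivity)
    measurable_div_add_norm_rpow.aemeasurable (fun t _ => hcont.intervalIntegrable _ _)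
    (.of_forall fun t => by positivity)
  have hl : ∀ v : EuclideanSpace ℝ (Fin 2),
      1 - ENNReal.ofReal ((1 - x / (x + ‖v‖ ^ α)) ^ K) =
        ENNReal.ofReal (∫ t in (0 : ℝ)..x / (x + ‖v‖ ^ α), K * |1 - t| ^ (K - 1)) := fun v => by
    have h1 := div_add_rpow_le_one (α := α) hx (norm_nonneg v)
    rw [intervalIntegral_one_sub_rpow hK (by positivity) h1,
      ENNReal.ofReal_sub _ (Real.rpow_nonneg (by linarith) _), ENNReal.ofReal_one]
  simp_rw [hl]
  rw [h, ← Set.Ioo_union_Ici_eq_Ioi (zero_lt_one' ℝ), lintegral_union measurableSet_Ici]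
  · rw [setLIntegral_congr_fun (s := Set.Ici 1) (g := fun _ => 0) measurableSet_Ici, lintegral_zero,
      add_zero]
    · refine setLIntegral_congr_fun measurableSet_Ioo fun t ht => ?_
      rw [abs_of_nonneg (by linarith [ht.2])]
    · intro t ht
      have : {v : EuclideanSpace ℝ (Fin 2) | t < x / (x + ‖v‖ ^ α)} = ∅ := by
        ext v
        have := div_add_rpow_le_one (α := α) hx (norm_nonneg v)
        simp only [Set.mem_ofPred_eq, Set.mem_empty_iff_false, iff_false, not_lt]
        exact this.trans ht
      simp [this]
  · exact Set.disjoint_left.2 fun t h1 h2 => absurd h1.2 (not_lt.2 h2)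

lemma div_add_rpow_mem_Ioo (hx : 0 < x) (hD : 0 < D) : x / (x + D ^ α) ∈ Set.Ioo (0 : ℝ) 1 := by
  have : 0 < D ^ α := by positivity
  refine ⟨by positivity, ?_⟩
  rw [div_lt_one (by positivity)]
  linarith

lemma div_add_rpow_antitone (hx : 0 < x) (hα : 0 < α) {r s : ℝ} (hr : 0 ≤ r) (hrs : r ≤ s) :
    x / (x + s ^ α) ≤ x / (x + r ^ α) := by
  have : 0 ≤ r ^ α := by positivity
  gcongr

lemma div_add_rpow_lt (hx : 0 < x) (hα : 0 < α) {r s : ℝ} (hr : 0 ≤ r) (hrs : r < s) :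
    x / (x + s ^ α) < x / (x + r ^ α) := by
  have : 0 ≤ r ^ α := by positivity
  gcongr

/-- Above the level t₀ = x/(x + D^α) the superlevel ball lies inside the disc and its area gives the
Beta integral. Up to t₀ it covers almost all of the disc, which leaves the constant area π D² times
∫₀^t₀ K (1-t)^(K-1) dt. -/
lemma lintegral_closedBall_one_sub_rpow (hx : 0 < x) (hα : 0 < α) (hD : 0 < D) (hK : 1 ≤ K) :
    ∫⁻ v in Metric.closedBall (0 : EuclideanSpace ℝ (Fin 2)) D,
        (1 - ENNReal.ofReal ((1 - x / (x + ‖v‖ ^ α)) ^ K)) =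
      ENNReal.ofReal (Real.pi * (K * x ^ (2 / α))) *
          upperIncBeta (x / (x + D ^ α)) (1 - 2 / α) (K + 2 / α) +
        ENNReal.ofReal (Real.pi * (D ^ 2 * (1 - (1 - x / (x + D ^ α)) ^ K))) := by
  obtain ⟨ht0, ht1⟩ := div_add_rpow_mem_Ioo (α := α) hx hD
  rw [lintegral_one_sub_rpow_eq_layercake hx hK]
  set t₀ := x / (x + D ^ α) with ht₀
  have hmeas : ∀ t : ℝ, MeasurableSet {v : EuclideanSpace ℝ (Fin 2) | t < x / (x + ‖v‖ ^ α)} :=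
    fun t => measurableSet_lt measurable_const measurable_div_add_norm_rpow
  rw [← Set.Ioc_union_Ioo_eq_Ioo ht0.le ht1, lintegral_union measurableSet_Ioo, add_comm]
  · congr 1
    · rw [upperIncBeta, ← lintegral_const_mul _ (by fun_prop)]
      refine setLIntegral_congr_fun measurableSet_Ioo fun t ht => ?_
      have htp : 0 < t := ht0.trans ht.1
      have h1t : 0 < 1 - t := by linarith [ht.2]
      rw [Measure.restrict_apply (hmeas t), Set.inter_eq_left.2,
        volume_setOf_lt_div_add_norm_rpow hx hα htp ht.2, ← ENNReal.ofReal_mul (by positivity),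
        ← ENNReal.ofReal_mul (by positivity)]
      · congr 1
        have e1 : (1 - t) ^ (K + 2 / α - 1) = (1 - t) ^ (2 / α) * (1 - t) ^ (K - 1) := by
          rw [← Real.rpow_add h1t]; congr 1; ring
        have e2 : (1 - 2 / α - 1) = -(2 / α) := by ring
        rw [e1, e2]
        ring
      · intro v hv
        rw [mem_closedBall_zero_iff]
        by_contra hlt
        exact absurd (ht.1.trans hv)
          (not_lt.2 (div_add_rpow_antitone hx hα hD.le (not_le.1 hlt).le))
    · rw [setLIntegral_congr_fun (g := fun t => ENNReal.ofReal (Real.pi * D ^ 2) *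
        ENNReal.ofReal (K * |1 - t| ^ (K - 1))) measurableSet_Ioc]
      · have hcont : Continuous fun t : ℝ => K * |1 - t| ^ (K - 1) :=
          continuous_const.mul ((by fun_prop : Continuous fun t : ℝ => |1 - t|).rpow_const
            fun _ => Or.inr (by linarith))
        rw [lintegral_const_mul _ (by fun_prop), ← ofReal_integral_eq_lintegral_ofReal
          (hcont.integrableOn_Icc.mono_set Set.Ioc_subset_Icc_self)
          (.of_forall fun t => by positivity), ← intervalIntegral.integral_of_le ht0.le,
          intervalIntegral_one_sub_rpow hK ht0.le ht1.le, ← ENNReal.ofReal_mul (by positivity),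
          mul_assoc]
      · intro t ht
        -- At t = t₀ the superlevel set is the open ball of radius D, so the bounding circle must be
        -- discarded.
        have hae : ({v : EuclideanSpace ℝ (Fin 2) | t < x / (x + ‖v‖ ^ α)} ∩
            Metric.closedBall 0 D : Set _) =ᵐ[volume] Metric.closedBall 0 D := by
          refine (Set.inter_subset_right.eventuallyLE).antisymm ?_
          refine ae_le_set.2 ?_
          refine measure_mono_null (t := Metric.sphere 0 D) ?_
            (Measure.addHaar_sphere_of_ne_zero _ _ hD.ne')
          intro v hv
          rw [mem_sphere_zero_iff_norm]
          have h1 := mem_closedBall_zero_iff.1 hv.1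
          by_contra hne
          exact hv.2 ⟨ht.2.trans_lt (div_add_rpow_lt hx hα (norm_nonneg v)
            (lt_of_le_of_ne h1 hne)), hv.1⟩
        simp only
        rw [Measure.restrict_apply (hmeas t), measure_congr hae,
          EuclideanSpace.volume_closedBall_fin_two, abs_of_nonneg (by linarith [ht.2]),
          ENNReal.ofReal_mul Real.pi_pos.le, ENNReal.ofReal_pow hD.le, mul_comm (ENNReal.ofReal D ^ 2)]
  · exact Set.disjoint_left.2 fun t h1 h2 => absurd h1.2 (not_le.2 h2.1)

/-- Only levels below t₀ reach outside the disc, and there the superlevel ball contains it. The Beta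
term counts whole balls; the disc's share is added on the left because subtraction in `[0, ∞]` would
fail to give an identity from which a finite term can be cancelled. -/
lemma lintegral_compl_closedBall_div_add (hx : 0 < x) (hα : 0 < α) (hD : 0 < D) :
    (∫⁻ v in (Metric.closedBall (0 : EuclideanSpace ℝ (Fin 2)) D)ᶜ,
        ENNReal.ofReal (x / (x + ‖v‖ ^ α))) +
        ENNReal.ofReal (Real.pi * (D ^ 2 * (x / (x + D ^ α)))) =
      ENNReal.ofReal (Real.pi * x ^ (2 / α)) *
        lowerIncBeta (x / (x + D ^ α)) (1 - 2 / α) (1 + 2 / α) := by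
  obtain ⟨ht0, ht1⟩ := div_add_rpow_mem_Ioo (α := α) hx hD
  rw [lintegral_eq_lintegral_meas_lt _ (.of_forall fun v => by positivity)
    measurable_div_add_norm_rpow.aemeasurable]
  set t₀ := x / (x + D ^ α) with ht₀
  have hmeas : ∀ t : ℝ, MeasurableSet {v : EuclideanSpace ℝ (Fin 2) | t < x / (x + ‖v‖ ^ α)} :=
    fun t => measurableSet_lt measurable_const measurable_div_add_norm_rpow
  have htail : ∫⁻ t in Set.Ici t₀, (volume.restrict (Metric.closedBall 0 D)ᶜ)
      {v : EuclideanSpace ℝ (Fin 2) | t < x / (x + ‖v‖ ^ α)} = 0 := by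
    rw [setLIntegral_congr_fun (g := fun _ => 0) measurableSet_Ici, lintegral_zero]
    intro t ht
    simp only
    rw [Measure.restrict_apply (hmeas t), Set.disjoint_iff_inter_eq_empty.1, measure_empty]
    refine Set.disjoint_left.2 fun v h1 h2 => ?_
    rw [Set.mem_compl_iff, mem_closedBall_zero_iff, not_le] at h2
    exact absurd (lt_of_le_of_lt ht h1) (not_lt.2 (div_add_rpow_antitone hx hα hD.le h2.le))
  have hconst : ENNReal.ofReal (Real.pi * (D ^ 2 * t₀)) =
      ∫⁻ t in Set.Ioo 0 t₀, volume (Metric.closedBall (0 : EuclideanSpace ℝ (Fin 2)) D) := by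
    rw [setLIntegral_const, Real.volume_Ioo, EuclideanSpace.volume_closedBall_fin_two,
      sub_zero, ← ENNReal.ofReal_pow hD.le, ← ENNReal.ofReal_mul (by positivity),
      ← ENNReal.ofReal_mul (by positivity)]
    congr 1; ring
  rw [← Set.Ioo_union_Ici_eq_Ioi ht0, lintegral_union measurableSet_Ici
    (Set.disjoint_left.2 fun t h1 h2 => absurd h1.2 (not_lt.2 h2)), htail, add_zero, hconst,
    ← lintegral_add_right _ measurable_const, lowerIncBeta,
    ← lintegral_const_mul _ (by fun_prop)]
  refine setLIntegral_congr_fun measurableSet_Ioo fun t ht => ?_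
  have h1t : 0 < 1 - t := by linarith [ht.2]
  have hp := ht.1
  have hsub : Metric.closedBall 0 D ⊆
      {v : EuclideanSpace ℝ (Fin 2) | t < x / (x + ‖v‖ ^ α)} := fun v hv =>
    ht.2.trans_le (div_add_rpow_antitone hx hα (norm_nonneg v) (mem_closedBall_zero_iff.1 hv))
  have hvol := measure_sdiff_add_inter (μ := volume)
    {v : EuclideanSpace ℝ (Fin 2) | t < x / (x + ‖v‖ ^ α)}
    (measurableSet_closedBall (x := (0 : EuclideanSpace ℝ (Fin 2))) (ε := D))
  rw [Set.inter_eq_right.2 hsub] at hvol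
  rw [Measure.restrict_apply (hmeas t), ← Set.sdiff_eq, hvol,
    volume_setOf_lt_div_add_norm_rpow hx hα ht.1 (ht.2.trans ht1),
    ← ENNReal.ofReal_mul (by positivity)]
  congr 1
  have e2 : (1 - 2 / α - 1) = -(2 / α) := by ring
  have e3 : (1 + 2 / α - 1) = (2 / α) := by ring
  rw [e2, e3]

/-- This controls the rate integrand near z = 0. Dropping the restriction to the disc and the powers
of 1 - t leaves ∫₀¹ t^(-2/α) dt, finite because α > 2. -/
lemma lintegral_closedBall_one_sub_rpow_le (hα : 2 < α) (hK : 1 ≤ K) (D : ℝ) :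
    ∃ C : ℝ≥0∞, C ≠ ∞ ∧ ∀ x : ℝ, 0 < x →
      ∫⁻ v in Metric.closedBall (0 : EuclideanSpace ℝ (Fin 2)) D,
        (1 - ENNReal.ofReal ((1 - x / (x + ‖v‖ ^ α)) ^ K)) ≤ C * ENNReal.ofReal (x ^ (2 / α)) := by
  refine ⟨ENNReal.ofReal (Real.pi * K) * ∫⁻ t in Set.Ioo (0 : ℝ) 1, ENNReal.ofReal (t ^ (-(2 / α))),
    ENNReal.mul_ne_top (by simp) ?_, fun x hx => ?_⟩
  · have h2 : (2 / α) < 1 := by rw [div_lt_one (by linarith)]; exact hα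
    have := (intervalIntegral.integrableOn_Ioo_rpow_iff (s := -(2 / α)) zero_lt_one).2
      (by linarith)
    refine (lintegral_ofReal_ne_top_iff_integrable (by fun_prop) ?_).2 this
    filter_upwards [ae_restrict_mem measurableSet_Ioo] with t ht
    exact Real.rpow_nonneg ht.1.le _
  · rw [lintegral_one_sub_rpow_eq_layercake hx hK, mul_assoc, mul_comm (lintegral _ _), ← mul_assoc,
      ← ENNReal.ofReal_mul (by positivity), ← lintegral_const_mul _ (by fun_prop)]
    refine setLIntegral_mono' measurableSet_Ioo fun t ht => ?_
    have h0 := ht.1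
    have h1 : 0 < 1 - t := by linarith [ht.2]
    have hα0 : 0 < α := by linarith
    refine (mul_le_mul_left (Measure.restrict_apply_le _ _) _).trans ?_
    rw [volume_setOf_lt_div_add_norm_rpow hx hα0 ht.1 ht.2,
      ← ENNReal.ofReal_mul (by positivity), ← ENNReal.ofReal_mul (by positivity)]
    refine ENNReal.ofReal_le_ofReal ?_
    have e1 : (1 - t) ^ (2 / α) ≤ 1 := Real.rpow_le_one h1.le (by linarith) (by positivity)
    have e2 : (1 - t) ^ (K - 1) ≤ 1 := Real.rpow_le_one h1.le (by linarith) (by linarith)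
    calc Real.pi * x ^ (2 / α) * (t ^ (-(2 / α)) * (1 - t) ^ (2 / α)) * (K * (1 - t) ^ (K - 1))
        ≤ Real.pi * x ^ (2 / α) * (t ^ (-(2 / α)) * 1) * (K * 1) := by gcongr
      _ = _ := by ring

/-- The integrand is at least 1/2 where ‖v‖ ≤ x^(1/α), and the assumption on x makes the area of the
annulus beyond D at least half of π x^(2/α); hence π/4. -/
lemma le_lintegral_compl_closedBall_div_add (hx : 0 < x) (hα : 0 < α) (hD : 0 < D)
    (hxD : 2 * D ^ 2 ≤ x ^ (2 / α)) :
    ENNReal.ofReal (Real.pi / 4 * x ^ (2 / α)) ≤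
      ∫⁻ v in (Metric.closedBall (0 : EuclideanSpace ℝ (Fin 2)) D)ᶜ,
        ENNReal.ofReal (x / (x + ‖v‖ ^ α)) := by
  have hsq : (x ^ (1 / α)) ^ 2 = x ^ (2 / α) := by
    rw [← Real.rpow_natCast, ← Real.rpow_mul hx.le]
    congr 1; push_cast; ring
  calc ENNReal.ofReal (Real.pi / 4 * x ^ (2 / α))
      ≤ ENNReal.ofReal (1 / 2) * (volume (Metric.ball (0 : EuclideanSpace ℝ (Fin 2)) (x ^ (1 / α))) -
          volume (Metric.closedBall (0 : EuclideanSpace ℝ (Fin 2)) D)) := by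
        rw [EuclideanSpace.volume_ball_fin_two, EuclideanSpace.volume_closedBall_fin_two,
          ← ENNReal.ofReal_pow (by positivity), ← ENNReal.ofReal_pow (by positivity),
          ← ENNReal.ofReal_mul (by positivity), ← ENNReal.ofReal_mul (by positivity),
          ← ENNReal.ofReal_sub _ (by positivity), ← ENNReal.ofReal_mul (by positivity), hsq]
        refine ENNReal.ofReal_le_ofReal ?_
        nlinarith [Real.pi_pos]
    _ ≤ ENNReal.ofReal (1 / 2) * volume (Metric.ball (0 : EuclideanSpace ℝ (Fin 2)) (x ^ (1 / α)) \
          Metric.closedBall (0 : EuclideanSpace ℝ (Fin 2)) D) := by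
        gcongr
        exact le_measure_sdiff
    _ = ∫⁻ v in Metric.ball (0 : EuclideanSpace ℝ (Fin 2)) (x ^ (1 / α)) \
          Metric.closedBall (0 : EuclideanSpace ℝ (Fin 2)) D, ENNReal.ofReal (1 / 2) := by
        rw [setLIntegral_const]
    _ ≤ ∫⁻ v in Metric.ball (0 : EuclideanSpace ℝ (Fin 2)) (x ^ (1 / α)) \
          Metric.closedBall (0 : EuclideanSpace ℝ (Fin 2)) D,
          ENNReal.ofReal (x / (x + ‖v‖ ^ α)) := by
        refine setLIntegral_mono' (measurableSet_ball.diff measurableSet_closedBall) fun v hv => ?_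
        refine ENNReal.ofReal_le_ofReal ?_
        have h1 : ‖v‖ ≤ x ^ (1 / α) := (mem_ball_zero_iff.1 hv.1).le
        have h2 : ‖v‖ ^ α ≤ x := by
          rw [one_div, Real.le_rpow_inv_iff_of_pos (norm_nonneg v) hx.le hα] at h1
          exact h1
        have h3 : 0 ≤ ‖v‖ ^ α := by positivity
        rw [div_le_div_iff₀ (by norm_num) (by positivity)]
        linarith
    _ ≤ _ := lintegral_mono_set fun v hv => hv.2

end Plane

/-! ### Elementary bounds, and the exponentials of `H1` and `H2` as plane integrals -/

lemma one_sub_negExp_le (u : ℝ≥0∞) : 1 - negExp u ≤ u := by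
  by_cases hu : u = ∞
  · simp [hu]
  · obtain ⟨x, hx, rfl⟩ : ∃ x : ℝ, 0 ≤ x ∧ ENNReal.ofReal x = u :=
      ⟨u.toReal, ENNReal.toReal_nonneg, ENNReal.ofReal_toReal hu⟩
    rw [negExp_ofReal hx, ← ENNReal.ofReal_one, ← ENNReal.ofReal_sub _ (Real.exp_pos _).le]
    refine ENNReal.ofReal_le_ofReal ?_
    linarith [Real.add_one_le_exp (-x)]

lemma negExp_ofReal_le_inv {x : ℝ} (hx : 0 < x) :
    negExp (ENNReal.ofReal x) ≤ ENNReal.ofReal x⁻¹ := by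
  rw [negExp_ofReal hx.le, Real.exp_neg]
  refine ENNReal.ofReal_le_ofReal (inv_anti₀ hx ?_)
  linarith [Real.add_one_le_exp x]

lemma inv_one_add_mul_rpow_neg {x r : ℝ} (hx : 0 < x) (hr : 0 < r) (α : ℝ) :
    (1 + x * r ^ (-α))⁻¹ = 1 - x / (x + r ^ α) := by
  have h : 0 < r ^ α := by positivity
  rw [Real.rpow_neg hr.le]
  field_simp
  ring

lemma one_add_mul_rpow_neg_rpow {x r : ℝ} (hx : 0 < x) (hr : 0 < r) (α K : ℝ) :
    (1 + x * r ^ (-α)) ^ (-K) = (1 - x / (x + r ^ α)) ^ K := by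
  have h : 0 < r ^ (-α) := by positivity
  rw [← inv_one_add_mul_rpow_neg hx hr, Real.rpow_neg (by positivity), Real.inv_rpow (by positivity)]

lemma exp_neg_mul_H1 {x K α D lam : ℝ} (hx : 0 < x) (hα : 0 < α) (hD : 0 < D) (hK : 1 ≤ K)
    (hlam : 0 ≤ lam) :
    EReal.exp (-(((Real.pi * lam : ℝ) : EReal) * H1 x K α D)) =
      negExp (ENNReal.ofReal lam * ∫⁻ v in Metric.closedBall (0 : EuclideanSpace ℝ (Fin 2)) D,
        (1 - ENNReal.ofReal ((1 - x / (x + ‖v‖ ^ α)) ^ K))) := by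
  obtain ⟨ht0, ht1⟩ := div_add_rpow_mem_Ioo (α := α) hx hD
  have hc : 0 ≤ D ^ 2 * (1 - (1 - x / (x + D ^ α)) ^ K) := by
    have := Real.rpow_le_one (x := 1 - x / (x + D ^ α)) (z := K) (by linarith) (by linarith)
      (by linarith)
    exact mul_nonneg (by positivity) (by linarith)
  rw [lintegral_closedBall_one_sub_rpow hx hα hD hK, H1, one_add_mul_rpow_neg_rpow hx hD, negExp]
  have e : ∀ {a : ℝ}, 0 ≤ a → (a : EReal) = (ENNReal.ofReal a : EReal) := fun h => by
    rw [EReal.coe_ennreal_ofReal, max_eq_left h]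
  rw [e hc, e (a := K * x ^ (2 / α)) (by positivity), e (a := Real.pi * lam) (by positivity),
    ← EReal.coe_ennreal_mul, ← EReal.coe_ennreal_add, ← EReal.coe_ennreal_mul,
    ENNReal.ofReal_mul Real.pi_pos.le, ENNReal.ofReal_mul Real.pi_pos.le,
    ENNReal.ofReal_mul Real.pi_pos.le]
  congr 3
  ring

lemma exp_neg_mul_H2 {x α D lam : ℝ} (hx : 0 < x) (hα : 0 < α) (hD : 0 < D) (hlam : 0 ≤ lam) :
    EReal.exp (-(((Real.pi * lam : ℝ) : EReal) * H2 x α D)) =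
      negExp (ENNReal.ofReal lam * ∫⁻ v in (Metric.closedBall (0 : EuclideanSpace ℝ (Fin 2)) D)ᶜ,
        ENNReal.ofReal (x / (x + ‖v‖ ^ α))) := by
  obtain ⟨ht0, ht1⟩ := div_add_rpow_mem_Ioo (α := α) hx hD
  have key := lintegral_compl_closedBall_div_add hx hα hD
  set J := ∫⁻ v in (Metric.closedBall (0 : EuclideanSpace ℝ (Fin 2)) D)ᶜ,
        ENNReal.ofReal (x / (x + ‖v‖ ^ α))
  set L := lowerIncBeta (x / (x + D ^ α)) (1 - 2 / α) (1 + 2 / α)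
  have hc : 0 ≤ Real.pi * (D ^ 2 * (x / (x + D ^ α))) := by positivity
  have e : ∀ {a : ℝ}, 0 ≤ a → (a : EReal) = (ENNReal.ofReal a : EReal) := fun h => by
    rw [EReal.coe_ennreal_ofReal, max_eq_left h]
  have key' : (J : EReal) + ((Real.pi * (D ^ 2 * (x / (x + D ^ α))) : ℝ) : EReal) =
      ((Real.pi * x ^ (2 / α) : ℝ) : EReal) * (L : EReal) := by
    rw [e hc, e (a := Real.pi * x ^ (2 / α)) (by positivity), ← EReal.coe_ennreal_mul, ← key,
      EReal.coe_ennreal_add]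
  -- The negative term of `H2` is a finite real, so it cancels the disc's share in `EReal` even when
  -- J = ∞.
  have hpi : ((Real.pi : ℝ) : EReal) * H2 x α D = J := by
    rw [H2, inv_one_add_mul_rpow_neg hx hD,
      EReal.left_distrib_of_nonneg_of_ne_top (by exact_mod_cast Real.pi_pos.le) (by simp), ← mul_assoc, ← EReal.coe_mul, ← EReal.coe_mul,
      ← key', add_comm, add_assoc, ← EReal.coe_add]
    ring_nf
    simp
  rw [mul_comm Real.pi lam, EReal.coe_mul, mul_assoc, hpi, negExp, e hlam, EReal.coe_ennreal_mul]

/-- The Laplace transform of the power received over a path of positive length with a gamma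
distributed gain. -/
lemma lintegral_negExp_pathloss {a r z α : ℝ} (ha : 0 < a) (hr : 0 < r) (hz : 0 < z)
    {v : EuclideanSpace ℝ (Fin 2)} (hv : v ≠ 0) :
    ∫⁻ s, negExp (ENNReal.ofReal z * (ENNReal.ofReal s * ‖v‖ₑ ^ (-α))) ∂(gammaMeasure a r) =
      ENNReal.ofReal ((1 - (z / r) / (z / r + ‖v‖ ^ α)) ^ a) := by
  have hv0 : 0 < ‖v‖ := norm_pos_iff.2 hv
  have h1 : ∀ s : ℝ, ENNReal.ofReal z * (ENNReal.ofReal s * ‖v‖ₑ ^ (-α)) =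
      ENNReal.ofReal s * ENNReal.ofReal (z * ‖v‖ ^ (-α)) := fun s => by
    rw [← ofReal_norm, ENNReal.ofReal_rpow_of_pos hv0, ENNReal.ofReal_mul hz.le]
    ring
  simp_rw [h1]
  rw [lintegral_negExp_gammaMeasure ha hr (by positivity),
    ← one_add_mul_rpow_neg_rpow (by positivity) hv0]
  congr 3
  ring

/-! ### Laplace transforms of the received powers -/

section Network

variable {Ω : Type*} (d : ℕ → Ω → EuclideanSpace ℝ (Fin 2)) (S G : ℕ → Ω → ℝ) (α D : ℝ)

lemma usefulPower_eq_tsum (ω : Ω) :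
    usefulPower d S α D ω = ∑' i, ENNReal.ofReal (S i ω) *
      (Metric.closedBall 0 D).indicator (fun v => ‖v‖ₑ ^ (-α)) (d i ω) := by
  rw [usefulPower, tsum_subtype (coopCluster d D ω)
    (fun i => ENNReal.ofReal (S i ω) * ‖d i ω‖ₑ ^ (-α))]
  refine tsum_congr fun i => ?_
  by_cases h : ‖d i ω‖ ≤ D <;> simp [Set.indicator, coopCluster, h]

lemma interferencePower_eq_tsum (ω : Ω) :
    interferencePower d G α D ω = ∑' i, ENNReal.ofReal (G i ω) *
      (Metric.closedBall 0 D)ᶜ.indicator (fun v => ‖v‖ₑ ^ (-α)) (d i ω) := by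
  rw [interferencePower, tsum_subtype (coopCluster d D ω)ᶜ
    (fun i => ENNReal.ofReal (G i ω) * ‖d i ω‖ₑ ^ (-α))]
  refine tsum_congr fun i => ?_
  by_cases h : ‖d i ω‖ ≤ D
  · simp [Set.indicator, coopCluster, h]
  · simp [Set.indicator, coopCluster, h]

variable {d S G α D} [MeasurableSpace Ω] {P : Measure Ω} {lam K r : ℝ}

lemma aemeasurable_tsum_gain_mul (hd : ∀ i, Measurable (d i)) (hS : ∀ i, AEMeasurable (S i) P)
    {w : EuclideanSpace ℝ (Fin 2) → ℝ≥0∞} (hw : Measurable w) :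
    AEMeasurable (fun ω => ∑' i, ENNReal.ofReal (S i ω) * w (d i ω)) P :=
  AEMeasurable.tsum fun i =>
    (hS i).ennreal_ofReal.mul (hw.comp (hd i)).aemeasurable

variable [IsProbabilityMeasure P]

/-- The Laplace transform of the total power received with gains `S` from `A` and gains `G` from
`A'`. -/
lemma lintegral_negExp_received (hd : IsHomogeneousPPP P lam d)
    (hS : ∀ i, HasLaw (S i) (gammaMeasure K r) P) (hG : ∀ i, HasLaw (G i) (gammaMeasure 1 1) P)
    (hgains : iIndepFun (fun i ω => (S i ω, G i ω)) P)
    (hindep : IndepFun (fun ω i => d i ω) (fun ω i => (S i ω, G i ω)) P)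
    (hK : 0 < K) (hr : 0 < r) {z : ℝ} (hz : 0 < z) {A A' : Set (EuclideanSpace ℝ (Fin 2))}
    (hA : MeasurableSet A) (hA' : MeasurableSet A') (hdisj : Disjoint A A') :
    ∫⁻ ω, negExp (ENNReal.ofReal z *
        ((∑' i, ENNReal.ofReal (S i ω) * A.indicator (fun v => ‖v‖ₑ ^ (-α)) (d i ω)) +
          ∑' i, ENNReal.ofReal (G i ω) * A'.indicator (fun v => ‖v‖ₑ ^ (-α)) (d i ω))) ∂P =
      negExp (ENNReal.ofReal lam *
        ((∫⁻ v in A, (1 - ENNReal.ofReal ((1 - (z / r) / (z / r + ‖v‖ ^ α)) ^ K))) +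
        ∫⁻ v in A', ENNReal.ofReal (z / (z + ‖v‖ ^ α)))) := by
  set pl : EuclideanSpace ℝ (Fin 2) → ℝ≥0∞ := fun v => ‖v‖ₑ ^ (-α)
  have hpl : Measurable pl := by fun_prop
  have hpS : ∀ v, Measurable fun s : ℝ => negExp (ENNReal.ofReal z * (ENNReal.ofReal s * pl v)) :=
    fun v => by fun_prop
  classical
  have hφ : ∀ i v, ∫⁻ ω, negExp (ENNReal.ofReal z * (ENNReal.ofReal (S i ω) * A.indicator pl v +
      ENNReal.ofReal (G i ω) * A'.indicator pl v)) ∂P =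
      if v ∈ A then ∫⁻ s, negExp (ENNReal.ofReal z * (ENNReal.ofReal s * pl v)) ∂(gammaMeasure K r)
      else if v ∈ A' then
        ∫⁻ s, negExp (ENNReal.ofReal z * (ENNReal.ofReal s * pl v)) ∂(gammaMeasure 1 1)
      else 1 := fun i v => by
    by_cases h1 : v ∈ A
    · have h2 : v ∉ A' := Set.disjoint_left.1 hdisj h1
      simp only [h1, h2, Set.indicator_of_mem, Set.indicator_of_notMem, not_false_eq_true, mul_zero,
        add_zero, if_true]
      rw [← (hS i).map_eq]
      exact (lintegral_map' (hpS v).aemeasurable (hS i).aemeasurable).symm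
    · by_cases h2 : v ∈ A'
      · simp only [h1, h2, Set.indicator_of_mem, Set.indicator_of_notMem, not_false_eq_true,
          mul_zero, zero_add, if_true, if_false]
        rw [← (hG i).map_eq]
        exact (lintegral_map' (hpS v).aemeasurable (hG i).aemeasurable).symm
      · simp [h1, h2]
  -- The mark is the pair (S, G). As A and A' are disjoint, each point uses at most one coordinate,
  -- so S i and G i need not be independent of each other.
  have hL := hd.laplace_marked (M := fun i ω => (S i ω, G i ω))
    (fun i => (hS i).aemeasurable.prodMk (hG i).aemeasurable) hgains hindep
    (h := fun v m => ENNReal.ofReal z * (ENNReal.ofReal m.1 * A.indicator pl v +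
      ENNReal.ofReal m.2 * A'.indicator pl v))
    (by
      have h1 := hpl.indicator hA
      have h2 := hpl.indicator hA'
      have : Measurable fun q : EuclideanSpace ℝ (Fin 2) × (ℝ × ℝ) =>
          ENNReal.ofReal z * (ENNReal.ofReal q.2.1 * A.indicator pl q.1 +
            ENNReal.ofReal q.2.2 * A'.indicator pl q.1) :=
        (((measurable_fst.comp measurable_snd).ennreal_ofReal.mul (h1.comp measurable_fst)).add
          ((measurable_snd.comp measurable_snd).ennreal_ofReal.mul
            (h2.comp measurable_fst))).const_mul _
      exact this)
    hφ
  simp_rw [ENNReal.tsum_mul_left, ENNReal.summable.tsum_add ENNReal.summable] at hL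
  rw [hL]
  congr 2
  rw [← lintegral_indicator hA, ← lintegral_indicator hA', ← lintegral_add_left
    (Measurable.indicator (by fun_prop) hA)]
  refine lintegral_congr_ae ?_
  -- At the origin the path loss is infinite and the closed form of the transform is not available;
  -- the origin is a null set.
  have hne : ∀ᵐ v : EuclideanSpace ℝ (Fin 2), v ≠ 0 := by
    simp [ae_iff]
  filter_upwards [hne] with v hv
  by_cases h1 : v ∈ A
  · have h2 : v ∉ A' := Set.disjoint_left.1 hdisj h1
    simp only [h1, h2, Set.indicator_of_mem, Set.indicator_of_notMem, not_false_eq_true,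
      add_zero, if_true]
    rw [lintegral_negExp_pathloss hK hr hz hv]
  · by_cases h2 : v ∈ A'
    · simp only [h1, h2, Set.indicator_of_mem, Set.indicator_of_notMem, not_false_eq_true,
        zero_add, if_true, if_false]
      rw [lintegral_negExp_pathloss one_pos one_pos hz hv, div_one, Real.rpow_one,
        ← ENNReal.ofReal_one, ← ENNReal.ofReal_sub _ (by
          linarith [div_add_rpow_le_one (α := α) hz (norm_nonneg v)])]
      congr 1
      ring
    · simp [h1, h2]

end Network

/-! ### Divergence at α = 2 and finiteness of the rate -/

/-- On (0, t/2] the integrand dominates (1-t)^(b-1) / s, whose integral diverges at 0. -/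
lemma lowerIncBeta_eq_top_of_nonpos {t a b : ℝ} (ht : 0 < t) (ht1 : t < 1) (ha : a ≤ 0)
    (hb : 1 ≤ b) : lowerIncBeta t a b = ∞ := by
  rw [eq_top_iff, lowerIncBeta]
  have hc : 0 < (1 - t) ^ (b - 1) := Real.rpow_pos_of_pos (by linarith) _
  calc ∞ = ENNReal.ofReal ((1 - t) ^ (b - 1)) * ∫⁻ u in Set.Ioc 0 (t / 2), ENNReal.ofReal u⁻¹ := by
        rw [setLIntegral_Ioc_zero_inv (by linarith), ENNReal.mul_top (by simpa using hc)]
    _ = ∫⁻ u in Set.Ioc 0 (t / 2), ENNReal.ofReal ((1 - t) ^ (b - 1)) * ENNReal.ofReal u⁻¹ :=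
        (lintegral_const_mul _ (by fun_prop)).symm
    _ ≤ ∫⁻ s in Set.Ioc 0 (t / 2), ENNReal.ofReal (s ^ (a - 1) * (1 - s) ^ (b - 1)) := by
        refine setLIntegral_mono' measurableSet_Ioc fun s hs => ?_
        have hs0 := hs.1
        have hs1 := hs.2
        rw [← ENNReal.ofReal_mul hc.le, mul_comm]
        refine ENNReal.ofReal_le_ofReal ?_
        gcongr ?_ * ?_
        · rw [← Real.rpow_neg_one]
          exact Real.rpow_le_rpow_of_exponent_ge hs0 (by linarith) (by linarith)
        · exact Real.rpow_le_rpow (by linarith) (by linarith) (by linarith)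
    _ ≤ _ := lintegral_mono_set fun s hs => Set.mem_Ioo.2 ⟨hs.1, by linarith [hs.1, hs.2]⟩

lemma lintegral_compl_closedBall_div_add_eq_top {x D : ℝ} (hx : 0 < x) (hD : 0 < D) :
    ∫⁻ v in (Metric.closedBall (0 : EuclideanSpace ℝ (Fin 2)) D)ᶜ,
      ENNReal.ofReal (x / (x + ‖v‖ ^ (2 : ℝ))) = ∞ := by
  obtain ⟨ht0, ht1⟩ := div_add_rpow_mem_Ioo (α := 2) hx hD
  have h := lintegral_compl_closedBall_div_add hx two_pos hD
  rw [lowerIncBeta_eq_top_of_nonpos ht0 ht1 (by norm_num) (by norm_num), ENNReal.mul_top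
    (by simpa using by positivity)] at h
  simpa using h

/-- The rate integral, with the exponents written as plane integrals, is finite. -/
lemma lintegral_rate_ne_top {lam p K α D : ℝ} (hlam : 0 < lam) (hp : 0 < p) (hα : 2 ≤ α)
    (hD : 0 < D) (hK : 1 ≤ K) :
    ∫⁻ z in Set.Ioi (0 : ℝ),
      (1 - negExp (ENNReal.ofReal lam * ∫⁻ v in Metric.closedBall (0 : EuclideanSpace ℝ (Fin 2)) D,
        (1 - ENNReal.ofReal ((1 - (z * p) / (z * p + ‖v‖ ^ α)) ^ K)))) / ENNReal.ofReal z *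
      negExp (ENNReal.ofReal lam * ∫⁻ v in (Metric.closedBall (0 : EuclideanSpace ℝ (Fin 2)) D)ᶜ,
        ENNReal.ofReal (z / (z + ‖v‖ ^ α))) ≠ ∞ := by
  rcases hα.eq_or_lt with rfl | hα
  · rw [setLIntegral_congr_fun (g := fun _ => 0) measurableSet_Ioi, lintegral_zero]
    · simp
    · intro z hz
      have hl : ENNReal.ofReal lam ≠ 0 := by simpa using hlam
      simp only
      rw [lintegral_compl_closedBall_div_add_eq_top hz hD, ENNReal.mul_top hl, negExp_top, mul_zero]
  have hα0 : 0 < α := by linarith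
  obtain ⟨C, hC, hJ⟩ := lintegral_closedBall_one_sub_rpow_le hα hK D
  -- Chosen so that z₀^(2/α) = 2 D², the threshold of the lower bound on the interference integral.
  set z₀ : ℝ := (2 * D ^ 2) ^ (α / 2) with hz₀
  have hz₀pos : 0 < z₀ := by positivity
  rw [← Set.Ioo_union_Ici_eq_Ioi hz₀pos, lintegral_union measurableSet_Ici
    (Set.disjoint_left.2 fun t h1 h2 => absurd h1.2 (not_lt.2 h2)), Ne, ENNReal.add_eq_top, not_or]
  constructor
  · refine ne_top_of_le_ne_top (b := ∫⁻ z in Set.Ioo 0 z₀,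
      (ENNReal.ofReal lam * C * ENNReal.ofReal (p ^ (2 / α))) *
        ENNReal.ofReal (z ^ (2 / α - 1))) ?_ ?_
    · rw [lintegral_const_mul _ (by fun_prop)]
      refine ENNReal.mul_ne_top (ENNReal.mul_ne_top (ENNReal.mul_ne_top (by simp) hC) (by simp)) ?_
      refine (lintegral_ofReal_ne_top_iff_integrable (by fun_prop) ?_).2
        ((intervalIntegral.integrableOn_Ioo_rpow_iff hz₀pos).2 ?_)
      · filter_upwards [ae_restrict_mem measurableSet_Ioo] with t ht
        exact Real.rpow_nonneg ht.1.le _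
      · have : 0 < 2 / α := by positivity
        linarith
    -- Near 0, bound the interference factor by 1 and use 1 - e^(-u) ≤ u.
    · refine setLIntegral_mono' measurableSet_Ioo fun z hz => ?_
      have hz0 := hz.1
      refine (mul_le_of_le_one_right zero_le (negExp_le_one _)).trans ?_
      refine (ENNReal.div_le_div_right ((one_sub_negExp_le _).trans
        (mul_le_mul_right (hJ (z * p) (by positivity)) _)) _).trans_eq ?_
      have e : z ^ (2 / α - 1) = z ^ (2 / α) * z⁻¹ := by
        rw [Real.rpow_sub hz0, Real.rpow_one, div_eq_mul_inv]
      rw [e, Real.mul_rpow hz0.le hp.le, ENNReal.ofReal_mul (by positivity),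
        ENNReal.ofReal_mul (by positivity), ENNReal.ofReal_inv_of_pos hz0, div_eq_mul_inv]
      ring
  -- For large z, bound 1 - e^(-u) by 1 and use e^(-y) ≤ 1/y with y = c z^(2/α).
  · set c := lam * (Real.pi / 4) with hcdef
    have hc : 0 < c := by positivity
    refine ne_top_of_le_ne_top (b := ∫⁻ z in Set.Ici z₀,
      ENNReal.ofReal c⁻¹ * ENNReal.ofReal (z ^ (-1 - 2 / α))) ?_ ?_
    · rw [lintegral_const_mul _ (by fun_prop)]
      refine ENNReal.mul_ne_top (by simp) ?_
      refine (lintegral_ofReal_ne_top_iff_integrable (by fun_prop) ?_).2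
        ((integrableOn_Ici_iff_integrableOn_Ioi (by simp)).2 (integrableOn_Ioi_rpow_of_lt ?_ hz₀pos))
      · filter_upwards [ae_restrict_mem measurableSet_Ici] with t ht
        exact Real.rpow_nonneg (hz₀pos.le.trans ht) _
      · have : 0 < 2 / α := by positivity
        linarith
    · refine setLIntegral_mono' measurableSet_Ici fun z hz => ?_
      have hz0 : 0 < z := hz₀pos.trans_le hz
      have hzD : 2 * D ^ 2 ≤ z ^ (2 / α) := by
        have h1 : z₀ ^ (2 / α) = 2 * D ^ 2 := by
          rw [hz₀, ← Real.rpow_mul (by positivity)]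
          have : α / 2 * (2 / α) = 1 := by field_simp
          rw [this, Real.rpow_one]
        rw [← h1]
        exact Real.rpow_le_rpow hz₀pos.le hz (by positivity)
      have hlow := le_lintegral_compl_closedBall_div_add hz0 hα0 hD hzD
      have hexp : negExp (ENNReal.ofReal lam *
          ∫⁻ v in (Metric.closedBall (0 : EuclideanSpace ℝ (Fin 2)) D)ᶜ,
            ENNReal.ofReal (z / (z + ‖v‖ ^ α))) ≤ ENNReal.ofReal (c * z ^ (2 / α))⁻¹ := by
        refine le_trans (negExp_antitone ?_) (negExp_ofReal_le_inv (by positivity))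
        rw [hcdef, mul_assoc, ENNReal.ofReal_mul hlam.le]
        gcongr
      refine (mul_le_mul' (ENNReal.div_le_div_right (tsub_le_self (a := 1)) _) hexp).trans_eq ?_
      rw [one_div, ← ENNReal.ofReal_inv_of_pos hz0, ← ENNReal.ofReal_mul (by positivity),
        ← ENNReal.ofReal_mul (by positivity)]
      congr 1
      have e : z ^ (-1 - 2 / α) = z⁻¹ * (z ^ (2 / α))⁻¹ := by
        rw [Real.rpow_sub hz0, Real.rpow_neg_one, div_eq_mul_inv]
      rw [e, mul_inv]
      ring

/-! ### The rate formula -/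

/-- `d i` are the positions of the base stations, `S i` is the effective gain of base station `i`
if it cooperates and `G i` its gain if it interferes. Gamma laws are given by shape and rate, the
rate being the inverse of the scale. `EReal.exp` is the exponential `[-∞, ∞] → [0, ∞]`. -/
theorem theorem3 {Ω : Type*} [MeasurableSpace Ω] (P : Measure Ω) [IsProbabilityMeasure P]
    (lam_t p_c α D : ℝ) (M_t : ℕ)
    (hlam : 0 < lam_t) (hpc : 0 < p_c) (hpc1 : p_c ≤ 1) (hα : 2 ≤ α) (hD : 0 < D) (hM : 2 ≤ M_t)
    (lam_b : ℝ) (hlamb : lam_b = lam_t / M_t)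
    (d : ℕ → Ω → EuclideanSpace ℝ (Fin 2)) (S G : ℕ → Ω → ℝ)
    (hd : IsHomogeneousPPP P lam_b d)
    (hS : ∀ i, HasLaw (S i) (gammaMeasure ((M_t : ℝ) - 1) (1 / p_c)) P)
    (hG : ∀ i, HasLaw (G i) (gammaMeasure 1 1) P)
    (hgains : iIndepFun (fun i ω => (S i ω, G i ω)) P)
    (hindep : IndepFun (fun ω i => d i ω) (fun ω i => (S i ω, G i ω)) P) :
    averageDataRate P d S G α D ≠ ∞ ∧
    averageDataRate P d S G α D =
      ∫⁻ z in Set.Ioi (0 : ℝ),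
        (1 - EReal.exp (-(((Real.pi * lam_b : ℝ) : EReal) *
              H1 (z * p_c) ((M_t : ℝ) - 1) α D))) / ENNReal.ofReal z *
          EReal.exp (-(((Real.pi * lam_b : ℝ) : EReal) * H2 z α D)) := by

  have hα0 : 0 < α := by linarith
  have hM' : (2 : ℝ) ≤ M_t := by exact_mod_cast hM
  have hK : (1 : ℝ) ≤ (M_t : ℝ) - 1 := by linarith
  have hlam0 : 0 < lam_b := by rw [hlamb]; positivity
  have hr : 0 < 1 / p_c := by positivity
  set B : Set (EuclideanSpace ℝ (Fin 2)) := Metric.closedBall 0 D with hB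
  have hBm : MeasurableSet B := measurableSet_closedBall
  set J₁ : ℝ → ℝ≥0∞ := fun x =>
    ∫⁻ v in B, (1 - ENNReal.ofReal ((1 - x / (x + ‖v‖ ^ α)) ^ ((M_t : ℝ) - 1))) with hJ₁
  set J₂ : ℝ → ℝ≥0∞ := fun z => ∫⁻ v in Bᶜ, ENNReal.ofReal (z / (z + ‖v‖ ^ α)) with hJ₂
  have hdiv : ∀ z : ℝ, z / (1 / p_c) = z * p_c := fun z => by field_simp
  have hXY : ∀ z : ℝ, 0 < z → ∫⁻ ω, negExp (ENNReal.ofReal z *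
      (usefulPower d S α D ω + interferencePower d G α D ω)) ∂P =
      negExp (ENNReal.ofReal lam_b * (J₁ (z * p_c) + J₂ z)) := fun z hz => by
    have h := lintegral_negExp_received (α := α) hd hS hG hgains hindep (by linarith) hr hz hBm
      hBm.compl disjoint_compl_right
    simp_rw [hdiv] at h
    simp_rw [usefulPower_eq_tsum, interferencePower_eq_tsum]
    exact h
  have hY : ∀ z : ℝ, 0 < z → ∫⁻ ω, negExp (ENNReal.ofReal z * interferencePower d G α D ω) ∂P =
      negExp (ENNReal.ofReal lam_b * J₂ z) := fun z hz => by
    -- An empty cooperating region removes the useful power and leaves the interference alone.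
    have h := lintegral_negExp_received (α := α) hd hS hG hgains hindep (by linarith) hr hz
      MeasurableSet.empty hBm.compl (Set.empty_disjoint _)
    simp only [Set.indicator_empty, mul_zero, tsum_zero, zero_add, Measure.restrict_empty,
      lintegral_zero_measure] at h
    simp_rw [interferencePower_eq_tsum]
    exact h
  have hpl : Measurable fun v : EuclideanSpace ℝ (Fin 2) => ‖v‖ₑ ^ (-α) := by fun_prop
  have hXm : AEMeasurable (usefulPower d S α D) P := by
    simp_rw [funext (usefulPower_eq_tsum d S α D)]
    exact aemeasurable_tsum_gain_mul hd.measurable (fun i => (hS i).aemeasurable)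
      (hpl.indicator hBm)
  have hYm : AEMeasurable (interferencePower d G α D) P := by
    simp_rw [funext (interferencePower_eq_tsum d G α D)]
    exact aemeasurable_tsum_gain_mul hd.measurable (fun i => (hG i).aemeasurable)
      (hpl.indicator hBm.compl)
  have hrate : averageDataRate P d S G α D = ∫⁻ z in Set.Ioi (0 : ℝ),
      (1 - negExp (ENNReal.ofReal lam_b * J₁ (z * p_c))) / ENNReal.ofReal z *
        negExp (ENNReal.ofReal lam_b * J₂ z) := by
    simp_rw [averageDataRate, sir, log_one_add_div_eq_lintegral]
    rw [lintegral_lintegral_swap]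
    · refine setLIntegral_congr_fun measurableSet_Ioi fun z hz => ?_
      have hm : AEMeasurable (fun ω => negExp (ENNReal.ofReal z *
          (usefulPower d S α D ω + interferencePower d G α D ω))) P :=
        measurable_negExp.comp_aemeasurable ((hXm.add hYm).const_mul _)
      have hne : (ENNReal.ofReal z)⁻¹ ≠ ∞ := by simpa using hz
      simp_rw [div_eq_mul_inv]
      -- Splitting the integral of the difference is legitimate because the subtracted term has
      -- finite integral and is pointwise the smaller; then e^(-λ J₂) is factored out.
      rw [lintegral_mul_const' _ _ hne, lintegral_sub' hm, hXY z hz, hY z hz, mul_add, negExp_add,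
        mul_right_comm, ENNReal.sub_mul (fun _ _ => negExp_ne_top _), one_mul]
      · rw [hXY z hz]
        exact negExp_ne_top _
      · exact .of_forall fun ω => negExp_antitone (mul_le_mul_right le_add_self _)
    · have hX' : AEMeasurable (fun q : Ω × ℝ => usefulPower d S α D q.1)
          (P.prod (volume.restrict (Set.Ioi 0))) := hXm.comp_fst
      have hY' : AEMeasurable (fun q : Ω × ℝ => interferencePower d G α D q.1)
          (P.prod (volume.restrict (Set.Ioi 0))) := hYm.comp_fst
      have hz' : AEMeasurable (fun q : Ω × ℝ => ENNReal.ofReal q.2)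
          (P.prod (volume.restrict (Set.Ioi 0))) := by fun_prop
      exact ((measurable_negExp.comp_aemeasurable (hz'.mul hY')).sub
        (measurable_negExp.comp_aemeasurable (hz'.mul (hX'.add hY')))).div hz'
  refine ⟨?_, ?_⟩
  · rw [hrate]
    exact lintegral_rate_ne_top hlam0 hpc hα hD hK
  · rw [hrate]
    refine setLIntegral_congr_fun measurableSet_Ioi fun z hz => ?_
    have hz0 : 0 < z := hz
    rw [exp_neg_mul_H1 (by positivity) hα0 hD hK hlam0.le, exp_neg_mul_H2 hz0 hα0 hD hlam0.le]
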